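/- For complex $x,q$ and an integer $n\ge 0$ let $(x;q)_n=\prod_{i=0}^{n-1}(1-xq^i)$ and $(x_1,\dots,x_m;q)_n=\prod_{i=1}^m (x_i;q)_n$, and let $$ {}_{10}\phi_9\left[\begin{matrix}a_1,\dots,a_{10}\\ b_1,\dots,b_9\end{matrix};q,z\right]=\sum_{j=0}^{\infty}\frac{(a_1,\dots,a_{10};q)_j}{(q,b_1,\dots,b_9;q)_j}\,z^j .$$ **Lemma.** Let $n\ge 0$ be an integer and let $a,k,q$ be nonzero complex numbers with $k\ne 1$. Fix any choices of the square roots $\sqrt a$, $\sqrt k$, $\sqrt{q/k}$, $\sqrt{kq}$. Assume that no denominator in the terms $j=0,\dots,n$ of the series below vanishes, i.e. $(q;q)_n\neq 0$ and $(b;q)_n\ne 0$ for each of its nine lower parameters $b$. (A term with $j>n$ whose numerator and denominator both vanish is read as $0$.) Then all terms with $j>n$ of the series vanish, and $$ {}_{10}\phi_9\left[\begin{matrix} a,\ q\sqrt a,\ -q\sqrt a,\ a\sqrt{\tfrac qk},\ -a\sqrt{\tfrac qk},\ \tfrac{a}{\sqrt k},\ -\tfrac{a}{\sqrt k},\ \tfrac{kq}{a},\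 kq^n,\ q^{-n}\\ \sqrt a,\ -\sqrt a,\ \sqrt{kq},\ -\sqrt{kq},\ q\sqrt k,\ -q\sqrt k,\ \tfrac{a^2}{k},\ \tfrac{aq^{1-n}}{k},\ aq^{n+1}\end{matrix};q,q\right]=\frac{1-k}{1-kq^{2n}}\,\frac{\left(aq,\ \tfrac{k^2q}{a^2};q\right)_n}{\left(k,\ \tfrac ka;q\right)_n}.$$ -/

import Mathlib

/-- The `q`-shifted factorial `(a; q)_n = ∏_{i < n} (1 - a q^i)`. -/
noncomputable def qPoch (a q : ℂ) (n : ℕ) : ℂ :=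
  ∏ i ∈ Finset.range n, (1 - a * q ^ i)

/-- The compact notation `(a₁, …, a_m; q)_n = (a₁; q)_n ⋯ (a_m; q)_n`. -/
noncomputable def qPochList (as : List ℂ) (q : ℂ) (n : ℕ) : ℂ :=
  (as.map (fun a => qPoch a q n)).prod

/-- The `j`-th term of the basic hypergeometric series `_rφ_s` with upper parameters `as`
(`r` of them), lower parameters `bs` (`s` of them), base `q` and argument `z`:
`(a₁, …, a_r; q)_j / (b₁, …, b_s, q; q)_j * ((-1)^j q^{j(j-1)/2})^{1+s-r} * z^j`. -/
noncomputable def basicHypTerm (as bs : List ℂ) (q z : ℂ) (j : ℕ) : ℂ :=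
  qPochList as q j / (qPochList bs q j * qPoch q q j)
    * ((-1) ^ j * q ^ (j.choose 2)) ^ (1 + (bs.length : ℤ) - (as.length : ℤ)) * z ^ j

/-- The basic hypergeometric series `_rφ_s[as; bs; q, z]`. -/
noncomputable def basicHyp (as bs : List ℂ) (q z : ℂ) : ℂ :=
  ∑' j : ℕ, basicHypTerm as bs q z j

/-- The ten upper parameters of the series, where `sa`, `sk`, `u` stand for
`√a`, `√k`, `√(q/k)`. -/
noncomputable def upperParams (a k q sa sk u : ℂ) (n : ℕ) : List ℂ :=
  [a, q * sa, -(q * sa), a * u, -(a * u), a / sk, -(a / sk), k * q / a,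
    k * q ^ n, q ^ (-(n : ℤ))]

/-- The nine lower parameters of the series, where `sa`, `sk`, `v` stand for
`√a`, `√k`, `√(kq)`. -/
noncomputable def lowerParams (a k q sa sk v : ℂ) (n : ℕ) : List ℂ :=
  [sa, -sa, v, -v, q * sk, -(q * sk), a ^ 2 / k, a * q ^ (1 - (n : ℤ)) / k,
    a * q ^ (n + 1)]

open Finset

/-! Pairing the parameters `±x` removes the square roots and turns the term into `wpTerm / (1 - a)`.
Its factor `(a²q^j/k, kq/a; q)_j / (q, kq^(j+1); q)_j` is the value of a balanced `₃φ₂`, so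
Pfaff–Saalschütz (`sum_saalschutzTerm`) expands it as a sum over `r ≤ j`. After interchanging the
sums, the inner sum over `j = r + i` is a very-well-poised `₆φ₅` of argument `q`, whose partial sums
have the closed form `sum_veryWellPoised`. That form contains `(q^(r-n+1); q)_(n-r)`, which vanishes
for `r < n`. Only the term `j = r = n` survives, and it is the right-hand side up to the factor `1 -
a`. -/

section qPochBasics

@[simp] theorem qPoch_zero (x q : ℂ) : qPoch x q 0 = 1 := by simp [qPoch]

theorem qPoch_succ (x q : ℂ) (n : ℕ) : qPoch x q (n + 1) = qPoch x q n * (1 - x * q ^ n) := by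
  simp [qPoch, prod_range_succ]

theorem qPoch_add (x q : ℂ) (m n : ℕ) :
    qPoch x q (m + n) = qPoch x q m * qPoch (x * q ^ m) q n := by
  simp only [qPoch, prod_range_add, pow_add, mul_assoc]

theorem qPoch_succ' (x q : ℂ) (n : ℕ) : qPoch x q (n + 1) = (1 - x) * qPoch (x * q) q n := by
  rw [add_comm n 1, qPoch_add]
  simp [qPoch]

theorem qPoch_ne_zero_of_le {x q : ℂ} {m n : ℕ} (h : qPoch x q n ≠ 0) (hmn : m ≤ n) :
    qPoch x q m ≠ 0 := by
  obtain ⟨d, rfl⟩ := Nat.exists_eq_add_of_le hmn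
  rw [qPoch_add] at h
  exact left_ne_zero_of_mul h

theorem qPoch_mul_pow_ne_zero {x q : ℂ} {l m n : ℕ} (h : qPoch x q n ≠ 0) (hmn : l + m ≤ n) :
    qPoch (x * q ^ l) q m ≠ 0 := by
  have := qPoch_ne_zero_of_le h hmn
  rw [qPoch_add] at this
  exact right_ne_zero_of_mul this

theorem qPoch_mul_qPoch_neg (x q : ℂ) (n : ℕ) :
    qPoch x q n * qPoch (-x) q n = qPoch (x ^ 2) (q ^ 2) n := by
  simp only [qPoch, ← prod_mul_distrib]
  exact prod_congr rfl fun i _ => by ring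

theorem qPoch_two_mul (x q : ℂ) (n : ℕ) :
    qPoch x (q ^ 2) n * qPoch (x * q) (q ^ 2) n = qPoch x q (2 * n) := by
  induction n with
  | zero => simp
  | succ n ih =>
    rw [show 2 * (n + 1) = 2 * n + 1 + 1 by ring, qPoch_succ, qPoch_succ, qPoch_succ, qPoch_succ,
      ← ih]
    ring

theorem qPoch_eq_zero_of_lt {x q : ℂ} {m n : ℕ} (h : x * q ^ m = 1) (hmn : m < n) :
    qPoch x q n = 0 :=
  prod_eq_zero (mem_range.2 hmn) (by rw [h, sub_self])

/-- Reversal of the order of the factors of `(x; q)_n`. -/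
theorem qPoch_reverse {x q y : ℂ} {n : ℕ} (hq : q ≠ 0) (hy : y * q ^ n * x = q) :
    qPoch y q n * x ^ n = qPoch x q n * ∏ i ∈ range n, (-(q ^ i)⁻¹) := by
  rw [qPoch, ← prod_range_reflect, qPoch, ← prod_mul_distrib, ← card_range n, ← prod_const,
    card_range, ← prod_mul_distrib]
  refine prod_congr rfl fun i hi => ?_
  obtain ⟨d, rfl⟩ := Nat.exists_eq_add_of_lt (mem_range.1 hi)
  have hqi : q ^ i ≠ 0 := pow_ne_zero _ hq
  rw [show i + d + 1 - 1 - i = d by omega]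
  have h : y * x * q ^ d * q ^ i = 1 := by
    apply mul_right_cancel₀ hq
    rw [one_mul]
    calc _ = y * q ^ (i + d + 1) * x := by ring
      _ = q := hy
  field_simp
  linear_combination -h

end qPochBasics

/-! ### The `q`-Pfaff–Saalschütz sum -/

/-- The terms of the terminating balanced `₃φ₂` series. -/
noncomputable def saalschutzTerm (A B D q : ℂ) (n r : ℕ) : ℂ :=
  qPoch A q r * qPoch B q r * qPoch D q (n - r) * D ^ r /
    (qPoch q q r * qPoch q q (n - r) * qPoch (A * B * D) q r)

/-- The telescoping companion of `saalschutzTerm`. -/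
noncomputable def saalschutzCert (A B D q : ℂ) (n : ℕ) : ℕ → ℂ
  | 0 => 0
  | r + 1 => -q ^ (n - r) * (qPoch A q (r + 1) * qPoch B q (r + 1) * qPoch D q (n - r) *
      D ^ (r + 1) / (qPoch q q r * qPoch q q (n - r) * qPoch (A * B * D) q r))

/-- Creative telescoping in `n`: summed over `r`, this gives the first-order recurrence of the
closed form. The usual `(q⁻ⁿ; q)_r q^r / (q^(1-n)/D; q)_r` is, up to a factor free of `r`, `(D;
q)_(n-r) D^r / (q; q)_(n-r)`, which involves no negative powers. -/
theorem saalschutzTerm_telescope {A B D q : ℂ} {n r : ℕ} (hr : r ≤ n)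
    (hq : qPoch q q (n + 1) ≠ 0) (hC : qPoch (A * B * D) q (n + 1) ≠ 0) :
    (1 - q ^ (n + 1)) * (1 - A * B * D * q ^ n) * saalschutzTerm A B D q (n + 1) r -
      (1 - A * D * q ^ n) * (1 - B * D * q ^ n) * saalschutzTerm A B D q n r =
    saalschutzCert A B D q n (r + 1) - saalschutzCert A B D q n r := by
  obtain ⟨d, rfl⟩ := Nat.exists_eq_add_of_le hr
  have hd1 : qPoch q q (d + 1) ≠ 0 := qPoch_ne_zero_of_le hq (by omega)
  rw [qPoch_succ] at hd1
  have hd := left_ne_zero_of_mul hd1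
  have hd' := right_ne_zero_of_mul hd1
  rcases r with _ | r
  · simp only [saalschutzTerm, saalschutzCert, Nat.sub_zero, zero_add, qPoch_zero, qPoch_succ,
      pow_zero, pow_succ, one_mul, sub_zero]
    generalize q ^ d = y at hd' ⊢
    generalize hz : 1 - q * y = z at hd' ⊢
    field_simp
    rw [← hz]
    ring
  · have hr1 : qPoch q q (r + 1) ≠ 0 := qPoch_ne_zero_of_le hq (by omega)
    have hC1 : qPoch (A * B * D) q (r + 1) ≠ 0 := qPoch_ne_zero_of_le hC (by omega)
    rw [qPoch_succ] at hr1 hC1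
    have h1 := left_ne_zero_of_mul hr1
    have h2 := right_ne_zero_of_mul hr1
    have h3 := left_ne_zero_of_mul hC1
    have h4 := right_ne_zero_of_mul hC1
    have e1 : r + 1 + d + 1 - (r + 1) = d + 1 := by omega
    have e2 : r + 1 + d - (r + 1) = d := by omega
    have e3 : r + 1 + d - r = d + 1 := by omega
    simp only [saalschutzTerm, saalschutzCert, e1, e2, e3, qPoch_succ, pow_add, pow_one]
    generalize q ^ d = y at hd' ⊢
    generalize q ^ r = x at h2 h4 ⊢
    generalize hz : 1 - q * y = z at hd' ⊢
    generalize hw : 1 - q * x = w at h2 ⊢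
    generalize hv : 1 - A * B * D * x = v at h4 ⊢
    field_simp
    rw [← hz, ← hw, ← hv]
    ring

/-- The `q`-Pfaff–Saalschütz summation. -/
theorem sum_saalschutzTerm {A B D q : ℂ} {n : ℕ}
    (hq : qPoch q q n ≠ 0) (hC : qPoch (A * B * D) q n ≠ 0) :
    ∑ r ∈ range (n + 1), saalschutzTerm A B D q n r =
      qPoch (A * D) q n * qPoch (B * D) q n / (qPoch q q n * qPoch (A * B * D) q n) := by
  induction n with
  | zero => simp [saalschutzTerm]
  | succ n ih =>
    have hq1 := hq
    have hC1 := hC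
    rw [qPoch_succ] at hq1 hC1
    have h1 := left_ne_zero_of_mul hq1
    have h2 := right_ne_zero_of_mul hq1
    have h3 := left_ne_zero_of_mul hC1
    have h4 := right_ne_zero_of_mul hC1
    have ih := ih h1 h3
    have tel := sum_congr rfl fun r hr =>
      saalschutzTerm_telescope (A := A) (B := B) (D := D) (Nat.lt_succ_iff.1 (mem_range.1 hr)) hq hC
    rw [sum_range_sub, sum_sub_distrib, ← mul_sum, ← mul_sum, ih] at tel
    -- The recurrence covers only `r ≤ n`; the extra term `r = n + 1` cancels the boundary value of
    -- the certificate.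
    have hlast : (1 - q ^ (n + 1)) * (1 - A * B * D * q ^ n) *
        saalschutzTerm A B D q (n + 1) (n + 1) = -saalschutzCert A B D q n (n + 1) := by
      simp only [saalschutzTerm, saalschutzCert, Nat.sub_self, qPoch_zero, qPoch_succ, pow_succ']
      generalize q ^ n = x at h2 h4 ⊢
      generalize hz : 1 - q * x = z at h2 ⊢
      generalize hv : 1 - A * B * D * x = v at h4 ⊢
      field_simp
    rw [sum_range_succ, qPoch_succ, qPoch_succ, qPoch_succ, qPoch_succ]
    have h2' : 1 - q ^ (n + 1) ≠ 0 := by rwa [pow_succ']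
    apply mul_left_cancel₀ (mul_ne_zero h2' h4)
    rw [mul_add, hlast]
    simp only [saalschutzCert] at tel ⊢
    have : (1 - q ^ (n + 1)) * (1 - A * B * D * q ^ n) * ((qPoch (A * D) q n *
        (1 - A * D * q ^ n)) * (qPoch (B * D) q n * (1 - B * D * q ^ n)) /
        ((qPoch q q n * (1 - q * q ^ n)) * (qPoch (A * B * D) q n * (1 - A * B * D * q ^ n)))) =
        (1 - A * D * q ^ n) * (1 - B * D * q ^ n) * (qPoch (A * D) q n * qPoch (B * D) q n /
          (qPoch q q n * qPoch (A * B * D) q n)) := by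
      rw [pow_succ']
      generalize q ^ n = x at h2 h4 ⊢
      generalize 1 - q * x = z at h2 ⊢
      generalize 1 - A * B * D * x = v at h4 ⊢
      field_simp
    rw [this]
    linear_combination tel

/-! ### Indefinite very-well-poised summation -/

/-- The partial sums of a very-well-poised `₆φ₅` series whose argument is `q`. -/
theorem sum_veryWellPoised {b c d q : ℂ} {M : ℕ} (hq : qPoch q q M ≠ 0)
    (h1 : qPoch (c * d * q) q M ≠ 0) (h2 : qPoch (b * d * q) q M ≠ 0)
    (h3 : qPoch (b * c * q) q M ≠ 0) :
    ∑ i ∈ range (M + 1), (1 - b * c * d * q ^ (2 * i)) *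
      (qPoch (b * c * d) q i * qPoch b q i * qPoch c q i * qPoch d q i) /
      (qPoch q q i * qPoch (c * d * q) q i * qPoch (b * d * q) q i * qPoch (b * c * q) q i) *
      q ^ i =
    qPoch (b * c * d) q (M + 1) * qPoch (b * q) q M * qPoch (c * q) q M * qPoch (d * q) q M /
      (qPoch q q M * qPoch (c * d * q) q M * qPoch (b * d * q) q M * qPoch (b * c * q) q M) := by
  induction M with
  | zero => simp [qPoch_succ]
  | succ M ih =>
    rw [qPoch_succ] at hq h1 h2 h3
    have g1 := left_ne_zero_of_mul hq
    have g2 := right_ne_zero_of_mul hq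
    have g3 := left_ne_zero_of_mul h1
    have g4 := right_ne_zero_of_mul h1
    have g5 := left_ne_zero_of_mul h2
    have g6 := right_ne_zero_of_mul h2
    have g7 := left_ne_zero_of_mul h3
    have g8 := right_ne_zero_of_mul h3
    -- Peeling the first factor of `(b; q)_(M+1)`, `(c; q)_(M+1)`, `(d; q)_(M+1)` exposes the
    -- products common to both summands; a polynomial identity remains.
    rw [sum_range_succ, ih g1 g3 g5 g7, qPoch_succ' b, qPoch_succ' c, qPoch_succ' d,
      qPoch_succ (b * c * d) q (M + 1)]
    simp only [qPoch_succ (b * q), qPoch_succ (c * q), qPoch_succ (d * q), qPoch_succ q,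
      qPoch_succ (c * d * q), qPoch_succ (b * d * q), qPoch_succ (b * c * q)]
    generalize qPoch (b * c * d) q (M + 1) = P0
    generalize qPoch (b * q) q M = P1
    generalize qPoch (c * q) q M = P2
    generalize qPoch (d * q) q M = P3
    rw [div_mul_eq_mul_div, div_add_div _ _ (by simp [*]) (by simp [*]),
      div_eq_div_iff (by simp [*]) (by simp [*])]
    generalize qPoch q q M = Q0
    generalize qPoch (c * d * q) q M = Q1
    generalize qPoch (b * d * q) q M = Q2
    generalize qPoch (b * c * q) q M = Q3
    ring

/-! ### Expansion into a double sum and its collapse -/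

/-- The terms of the series, free of square roots and with the factor `1 - a` removed; here `D`
stands for `q⁻ⁿ`. -/
noncomputable def wpTerm (a k q D : ℂ) (n j : ℕ) : ℂ :=
  (1 - a * q ^ (2 * j)) * (qPoch a q j * qPoch (a ^ 2 / k * q ^ j) q j * qPoch (k * q / a) q j *
    qPoch (k * q ^ n) q j * qPoch D q j) /
    (qPoch q q j * qPoch (k * q) q (2 * j) * qPoch (a / k * D * q) q j *
      qPoch (a * q ^ (n + 1)) q j) * q ^ j

/-- The summands of the expansion of `wpTerm` by the `q`-Pfaff–Saalschütz summation. -/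
noncomputable def wpDoubleTerm (a k q D : ℂ) (n j r : ℕ) : ℂ :=
  qPoch (k ^ 2 * q / a ^ 2) q r / qPoch q q r * (a / k) ^ r *
    ((1 - a * q ^ (2 * j)) * (qPoch a q (j + r) * qPoch (a / k) q (j - r) * qPoch (k * q ^ n) q j *
      qPoch D q j) /
      (qPoch q q (j - r) * qPoch (k * q) q (j + r) * qPoch (a / k * D * q) q j *
        qPoch (a * q ^ (n + 1)) q j) * q ^ j)

theorem wpTerm_eq_sum {a k q D : ℂ} {n j : ℕ} (ha : a ≠ 0) (hk : k ≠ 0) (hq : qPoch q q j ≠ 0)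
    (hkq : qPoch (k * q) q (2 * j) ≠ 0) :
    wpTerm a k q D n j = ∑ r ∈ range (j + 1), wpDoubleTerm a k q D n j r := by
  have hC : a * q ^ j * (k ^ 2 * q / a ^ 2) * (a / k) = k * q * q ^ j := by field_simp
  have hAD : a * q ^ j * (a / k) = a ^ 2 / k * q ^ j := by ring
  have hBD : k ^ 2 * q / a ^ 2 * (a / k) = k * q / a := by field_simp
  rw [two_mul, qPoch_add] at hkq
  have h1 := left_ne_zero_of_mul hkq
  have h2 := right_ne_zero_of_mul hkq
  have hs := sum_saalschutzTerm (A := a * q ^ j) (B := k ^ 2 * q / a ^ 2) (D := a / k) hq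
    (by rwa [hC])
  rw [hC, hAD, hBD] at hs
  calc wpTerm a k q D n j = (1 - a * q ^ (2 * j)) * (qPoch a q j * qPoch (k * q ^ n) q j *
        qPoch D q j) / (qPoch (k * q) q j * qPoch (a / k * D * q) q j *
        qPoch (a * q ^ (n + 1)) q j) * q ^ j *
        (qPoch (a ^ 2 / k * q ^ j) q j * qPoch (k * q / a) q j /
          (qPoch q q j * qPoch (k * q * q ^ j) q j)) := by
        rw [wpTerm, two_mul j, qPoch_add (k * q)]
        simp only [div_eq_mul_inv, mul_inv]
        ring
    _ = _ := by
        rw [← hs, mul_sum]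
        refine sum_congr rfl fun r _ => ?_
        rw [wpDoubleTerm, saalschutzTerm, hC, qPoch_add a, qPoch_add (k * q)]
        simp only [div_eq_mul_inv, mul_inv]
        ring

theorem wpDoubleTerm_add {a k q D : ℂ} {n r i : ℕ} :
    wpDoubleTerm a k q D n (r + i) r =
      qPoch (k ^ 2 * q / a ^ 2) q r / qPoch q q r * (a / k) ^ r *
        (qPoch a q (2 * r) * qPoch (k * q ^ n) q r * qPoch D q r /
          (qPoch (k * q) q (2 * r) * qPoch (a / k * D * q) q r * qPoch (a * q ^ (n + 1)) q r) *
          q ^ r) *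
        ((1 - a * q ^ (2 * r) * q ^ (2 * i)) *
          (qPoch (a * q ^ (2 * r)) q i * qPoch (a / k) q i * qPoch (k * q ^ n * q ^ r) q i *
            qPoch (D * q ^ r) q i) /
          (qPoch q q i * qPoch (k * q * q ^ (2 * r)) q i * qPoch (a / k * D * q * q ^ r) q i *
            qPoch (a * q ^ (n + 1) * q ^ r) q i) * q ^ i) := by
  rw [wpDoubleTerm, show r + i + r = 2 * r + i by ring, Nat.add_sub_cancel_left]
  simp only [qPoch_add, mul_add 2 r i, pow_add q r i, pow_add q (2 * r) (2 * i)]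
  simp only [div_eq_mul_inv, mul_inv]
  ring

theorem sum_wpDoubleTerm {a k q D : ℂ} {n r : ℕ} (hk : k ≠ 0) (hr : r < n) (hD : D * q ^ n = 1)
    (hq : qPoch q q n ≠ 0) (hkq : qPoch (k * q) q (2 * n) ≠ 0)
    (h1 : qPoch (a / k * D * q) q n ≠ 0) (h2 : qPoch (a * q ^ (n + 1)) q n ≠ 0) :
    ∑ i ∈ range (n - r + 1), wpDoubleTerm a k q D n (r + i) r = 0 := by
  simp only [wpDoubleTerm_add]
  rw [← mul_sum]
  have e0 : a / k * (k * q ^ n * q ^ r) * (D * q ^ r) = a * q ^ (2 * r) := by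
    field_simp
    linear_combination a * q ^ (2 * r) * hD
  have e1 : k * q ^ n * q ^ r * (D * q ^ r) * q = k * q * q ^ (2 * r) := by
    linear_combination k * q * q ^ (2 * r) * hD
  have e2 : a / k * (D * q ^ r) * q = a / k * D * q * q ^ r := by ring
  have e3 : a / k * (k * q ^ n * q ^ r) * q = a * q ^ (n + 1) * q ^ r := by
    field_simp
    ring
  have hs := sum_veryWellPoised (b := a / k) (c := k * q ^ n * q ^ r) (d := D * q ^ r) (q := q)
    (M := n - r) (qPoch_ne_zero_of_le hq (by omega))
    (by rw [e1]; exact qPoch_mul_pow_ne_zero hkq (by omega))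
    (by rw [e2]; exact qPoch_mul_pow_ne_zero h1 (by omega))
    (by rw [e3]; exact qPoch_mul_pow_ne_zero h2 (by omega))
  -- The last factor is `1 - D q^n = 0`; it is present because `r < n`.
  have hz : qPoch (D * q ^ r * q) q (n - r) = 0 := by
    refine qPoch_eq_zero_of_lt (m := n - r - 1) ?_ (by omega)
    rw [← hD, mul_assoc, mul_assoc, ← pow_succ', ← pow_add]
    congr 2
    omega
  rw [e0, e1, e2, e3, hz, mul_zero, zero_div] at hs
  rw [hs, mul_zero]

theorem sum_wpTerm {a k q D : ℂ} {n : ℕ} (ha : a ≠ 0) (hk : k ≠ 0) (hD : D * q ^ n = 1)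
    (hq : qPoch q q n ≠ 0) (hkq : qPoch (k * q) q (2 * n) ≠ 0)
    (h1 : qPoch (a / k * D * q) q n ≠ 0) (h2 : qPoch (a * q ^ (n + 1)) q n ≠ 0) :
    ∑ j ∈ range (n + 1), wpTerm a k q D n j = wpDoubleTerm a k q D n n n := by
  calc ∑ j ∈ range (n + 1), wpTerm a k q D n j
      = ∑ j ∈ range (n + 1), ∑ r ∈ range (j + 1), wpDoubleTerm a k q D n j r :=
        sum_congr rfl fun j hj => by
          have := mem_range.1 hj
          exact wpTerm_eq_sum ha hk (qPoch_ne_zero_of_le hq (by omega))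
            (qPoch_ne_zero_of_le hkq (by omega))
    _ = ∑ r ∈ range (n + 1), ∑ j ∈ Ico r (n + 1), wpDoubleTerm a k q D n j r :=
        sum_comm' fun j r => by simp only [mem_range, mem_Ico]; omega
    _ = ∑ r ∈ range (n + 1), ∑ i ∈ range (n - r + 1), wpDoubleTerm a k q D n (r + i) r :=
        sum_congr rfl fun r hr => by
          have := mem_range.1 hr
          rw [sum_Ico_eq_sum_range, show n + 1 - r = n - r + 1 by omega]
    _ = wpDoubleTerm a k q D n n n := by
        rw [sum_range_succ, sum_eq_zero fun r hr =>
          sum_wpDoubleTerm hk (mem_range.1 hr) hD hq hkq h1 h2]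
        simp

theorem wpDoubleTerm_self {a k q D : ℂ} {n : ℕ} (ha : a ≠ 0) (hk : k ≠ 0) (hk1 : k ≠ 1)
    (hq0 : q ≠ 0) (hD : D * q ^ n = 1)
    (hq : qPoch q q n ≠ 0) (hkq : qPoch (k * q) q (2 * n) ≠ 0)
    (h1 : qPoch (a / k * D * q) q n ≠ 0) (h2 : qPoch (a * q ^ (n + 1)) q n ≠ 0) :
    wpDoubleTerm a k q D n n n = (1 - a) * ((1 - k) / (1 - k * q ^ (2 * n)) *
      (qPoch (a * q) q n * qPoch (k ^ 2 * q / a ^ 2) q n / (qPoch k q n * qPoch (k / a) q n))) := by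
  -- Both reversals produce the same product of signs and powers of `q`, which cancels in `e3`.
  have r1 := qPoch_reverse (x := q) (y := D) (n := n) hq0 (by rw [hD, one_mul])
  have r2 := qPoch_reverse (x := k / a) (y := a / k * D * q) (n := n) hq0 (by
    field_simp
    linear_combination hD)
  have hw : ∏ i ∈ range n, (-(q ^ i)⁻¹) ≠ 0 := by
    simp [prod_ne_zero_iff, hq0]
  generalize ∏ i ∈ range n, (-(q ^ i)⁻¹) = w at *
  -- `(k/a; q)_n` is, up to a nonzero factor, the reversal of the lower-parameter product
  -- `(aq^(1-n)/k; q)_n`.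
  have hka : qPoch (k / a) q n ≠ 0 := fun h => by
    rw [h, zero_mul] at r2
    exact mul_ne_zero h1 (pow_ne_zero _ (div_ne_zero hk ha)) r2
  have hkk : qPoch k q (2 * n + 1) ≠ 0 := by
    rw [qPoch_succ']
    exact mul_ne_zero (sub_ne_zero.2 hk1.symm) hkq
  have e1 : qPoch k q n * qPoch (k * q ^ n) q n * (1 - k * q ^ (2 * n)) =
      (1 - k) * qPoch (k * q) q (2 * n) := by
    rw [← qPoch_add, ← two_mul, ← qPoch_succ, qPoch_succ']
  have e2 : (1 - a * q ^ (2 * n)) * qPoch a q (2 * n) =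
      (1 - a) * (qPoch (a * q) q n * qPoch (a * q ^ (n + 1)) q n) := by
    rw [mul_comm, ← qPoch_succ, qPoch_succ', two_mul, qPoch_add, pow_succ', mul_assoc a]
  have hkn : qPoch k q n ≠ 0 := qPoch_ne_zero_of_le hkk (by omega)
  rw [qPoch_succ] at hkk
  have hk2 := right_ne_zero_of_mul hkk
  have e1' : qPoch (k * q ^ n) q n / qPoch (k * q) q (2 * n) =
      (1 - k) / (1 - k * q ^ (2 * n)) / qPoch k q n := by
    rw [div_div, div_eq_div_iff hkq (mul_ne_zero hk2 hkn)]
    linear_combination e1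
  have e3 : qPoch D q n * q ^ n * (a / k) ^ n / (qPoch (a / k * D * q) q n * qPoch q q n) =
      1 / qPoch (k / a) q n := by
    rw [r1, div_eq_div_iff (mul_ne_zero h1 hq) hka]
    have : (a / k) ^ n * (k / a) ^ n = 1 := by
      rw [← mul_pow, div_mul_div_comm, mul_comm k a, div_self (mul_ne_zero ha hk), one_pow]
    linear_combination (-qPoch q q n * (a / k) ^ n) * r2 +
      qPoch q q n * qPoch (a / k * D * q) q n * this
  rw [wpDoubleTerm, ← two_mul, Nat.sub_self, qPoch_zero, qPoch_zero]
  calc _ = qPoch (k ^ 2 * q / a ^ 2) q n * ((1 - a * q ^ (2 * n)) * qPoch a q (2 * n)) /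
        qPoch (a * q ^ (n + 1)) q n * (qPoch (k * q ^ n) q n / qPoch (k * q) q (2 * n)) *
        (qPoch D q n * q ^ n * (a / k) ^ n / (qPoch (a / k * D * q) q n * qPoch q q n)) := by
        simp only [div_eq_mul_inv, mul_inv]
        ring
    _ = _ := by
        rw [e1', e2, e3]
        field_simp

/-! ### Elimination of the square roots -/

theorem qPoch_mul_sq_root (x q : ℂ) (j : ℕ) :
    qPoch (q * x) q j * qPoch (-(q * x)) q j * (1 - x ^ 2) =
      qPoch x q j * qPoch (-x) q j * (1 - x ^ 2 * q ^ (2 * j)) := by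
  rw [qPoch_mul_qPoch_neg, qPoch_mul_qPoch_neg, pow_mul, ← qPoch_succ, qPoch_succ',
    mul_pow, mul_comm (q ^ 2), mul_comm]

/-- The pairs give base `q²` products starting at `z` and `zq`, which interleave. It applies above
with `z = a²/k` and below with `z = kq`. -/
theorem qPoch_four_roots {x y z q : ℂ} (j : ℕ) (hx : x ^ 2 = z) (hy : y ^ 2 = z * q) :
    qPoch x q j * qPoch (-x) q j * (qPoch y q j * qPoch (-y) q j) = qPoch z q (2 * j) := by
  rw [qPoch_mul_qPoch_neg, qPoch_mul_qPoch_neg, hx, hy, qPoch_two_mul]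

theorem basicHypTerm_eq_wpTerm {a k q sa sk u v : ℂ} {n j : ℕ}
    (hq : q ≠ 0) (hsa : sa ^ 2 = a) (hsk : sk ^ 2 = k) (hu : u ^ 2 = q / k) (hv : v ^ 2 = k * q)
    (ha1 : 1 - a ≠ 0) (h1 : qPoch sa q j ≠ 0) (h2 : qPoch (-sa) q j ≠ 0)
    (h3 : qPoch (a ^ 2 / k) q j ≠ 0) :
    basicHypTerm (upperParams a k q sa sk u n) (lowerParams a k q sa sk v n) q q j =
      wpTerm a k q (q ^ (-(n : ℤ))) n j / (1 - a) := by
  have e1 := qPoch_mul_sq_root sa q j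
  rw [hsa] at e1
  have e1' : qPoch (q * sa) q j * qPoch (-(q * sa)) q j / (qPoch sa q j * qPoch (-sa) q j) =
      (1 - a * q ^ (2 * j)) / (1 - a) := by
    rw [div_eq_div_iff (mul_ne_zero h1 h2) ha1, e1, mul_comm]
  have e2 := qPoch_four_roots (x := a / sk) (y := a * u) (z := a ^ 2 / k) (q := q) j
    (by rw [div_pow, hsk]) (by rw [mul_pow, hu]; ring)
  rw [two_mul, qPoch_add] at e2
  have e2' : qPoch (a / sk) q j * qPoch (-(a / sk)) q j *
      (qPoch (a * u) q j * qPoch (-(a * u)) q j) / qPoch (a ^ 2 / k) q j =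
      qPoch (a ^ 2 / k * q ^ j) q j := by
    rw [e2, mul_div_cancel_left₀ _ h3]
  have e3 := qPoch_four_roots (x := v) (y := q * sk) (z := k * q) (q := q) j hv
    (by rw [mul_pow, hsk]; ring)
  have e4 : a * q ^ (1 - (n : ℤ)) / k = a / k * q ^ (-(n : ℤ)) * q := by
    rw [sub_eq_add_neg, zpow_add₀ hq, zpow_one]
    ring
  have e5 : (1 + ((lowerParams a k q sa sk v n).length : ℤ) -
      ((upperParams a k q sa sk u n).length : ℤ)) = 0 := by
    simp [lowerParams, upperParams]
  rw [basicHypTerm, e5, zpow_zero, mul_one]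
  simp only [upperParams, lowerParams, qPochList, List.map, List.prod_cons, List.prod_nil, mul_one,
    e4]
  calc _ = qPoch (q * sa) q j * qPoch (-(q * sa)) q j / (qPoch sa q j * qPoch (-sa) q j) *
        (qPoch (a / sk) q j * qPoch (-(a / sk)) q j *
          (qPoch (a * u) q j * qPoch (-(a * u)) q j) / qPoch (a ^ 2 / k) q j) *
        (qPoch a q j * qPoch (k * q / a) q j * qPoch (k * q ^ n) q j *
          qPoch (q ^ (-(n : ℤ))) q j) /
        (qPoch q q j * (qPoch v q j * qPoch (-v) q j * (qPoch (q * sk) q j *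
          qPoch (-(q * sk)) q j)) * qPoch (a / k * q ^ (-(n : ℤ)) * q) q j *
          qPoch (a * q ^ (n + 1)) q j) * q ^ j := by
        simp only [div_eq_mul_inv, mul_inv]
        ring
    _ = _ := by
        rw [e1', e2', e3, wpTerm]
        simp only [div_eq_mul_inv, mul_inv]
        ring

theorem mainTheorem4 (a k q : ℂ) (n : ℕ)
    (ha : a ≠ 0) (hk : k ≠ 0) (hq : q ≠ 0) (hk1 : k ≠ 1)
    -- arbitrary choices of the square roots `√a`, `√k`, `√(q/k)`, `√(kq)`
    (sa sk u v : ℂ) (hsa : sa ^ 2 = a) (hsk : sk ^ 2 = k)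
    (hu : u ^ 2 = q / k) (hv : v ^ 2 = k * q)
    -- no denominator of the terms `j = 0, …, n` of the series vanishes
    (hqn : qPoch q q n ≠ 0)
    (hden : ∀ b ∈ lowerParams a k q sa sk v n, qPoch b q n ≠ 0) :
    -- the series terminates
    (∀ j : ℕ, n < j →
      basicHypTerm (upperParams a k q sa sk u n) (lowerParams a k q sa sk v n) q q j = 0) ∧
    -- and its sum is
    basicHyp (upperParams a k q sa sk u n) (lowerParams a k q sa sk v n) q q =
      (1 - k) / (1 - k * q ^ (2 * n)) *
        (qPochList [a * q, k ^ 2 * q / a ^ 2] q n / qPochList [k, k / a] q n) := by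
  have hD : q ^ (-(n : ℤ)) * q ^ n = 1 := by
    rw [zpow_neg, zpow_natCast, inv_mul_cancel₀ (pow_ne_zero _ hq)]
  have hvan : ∀ j : ℕ, n < j →
      basicHypTerm (upperParams a k q sa sk u n) (lowerParams a k q sa sk v n) q q j = 0 := by
    intro j hj
    have h0 : qPochList (upperParams a k q sa sk u n) q j = 0 :=
      List.prod_eq_zero (List.mem_map.2 ⟨_, by simp [upperParams], qPoch_eq_zero_of_lt hD hj⟩)
    rw [basicHypTerm, h0, zero_div, zero_mul, zero_mul]
  refine ⟨hvan, ?_⟩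
  rw [basicHyp, tsum_eq_sum (s := range (n + 1)) fun j hj =>
    hvan j (by rw [mem_range] at hj; omega)]
  -- For `n = 0` the hypotheses allow `a = 1`; for `n ≥ 1` the lower parameters `±√a` force `1 - a ≠
  -- 0`.
  rcases Nat.eq_zero_or_pos n with rfl | hn
  · have : 1 - k ≠ 0 := sub_ne_zero.2 hk1.symm
    simp [basicHypTerm, qPochList, this]
  have e4 : a * q ^ (1 - (n : ℤ)) / k = a / k * q ^ (-(n : ℤ)) * q := by
    rw [sub_eq_add_neg, zpow_add₀ hq, zpow_one]
    ring
  simp only [lowerParams, List.forall_mem_cons, e4] at hden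
  obtain ⟨h1, h2, h3, h4, h5, h6, h7, h8, h9, -⟩ := hden
  have ha1 : 1 - a ≠ 0 := by
    have g1 := qPoch_ne_zero_of_le h1 hn
    have g2 := qPoch_ne_zero_of_le h2 hn
    rw [← hsa]
    intro h
    apply mul_ne_zero g1 g2
    rw [qPoch_mul_qPoch_neg]
    simpa [qPoch] using h
  have hkq : qPoch (k * q) q (2 * n) ≠ 0 := by
    rw [← qPoch_four_roots (x := v) (y := q * sk) n hv (by rw [mul_pow, hsk]; ring)]
    exact mul_ne_zero (mul_ne_zero h3 h4) (mul_ne_zero h5 h6)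
  calc _ = ∑ j ∈ range (n + 1), wpTerm a k q (q ^ (-(n : ℤ))) n j / (1 - a) :=
        sum_congr rfl fun j hj => by
          have hj := Nat.lt_succ_iff.1 (mem_range.1 hj)
          exact basicHypTerm_eq_wpTerm hq hsa hsk hu hv ha1 (qPoch_ne_zero_of_le h1 hj)
            (qPoch_ne_zero_of_le h2 hj) (qPoch_ne_zero_of_le h7 hj)
    _ = _ := by
        rw [← sum_div, sum_wpTerm ha hk hD hqn hkq h8 h9,
          wpDoubleTerm_self ha hk hk1 hq hD hqn hkq h8 h9, mul_div_cancel_left₀ _ ha1]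
        simp [qPochList]
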